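/- Let $\Gamma$ be a countably infinite group with identity element $\mathbf 1$. Fix an integer $k \ge 2$, a finite set $R \subset \Gamma$, and a group element $\gamma \ne \mathbf 1$. Then there is a finite set $S \subset \Gamma$ with the following property. Let $\Gamma$ act continuously (that is, each map $x \mapsto \sigma\cdot x$, $\sigma\in\Gamma$, is continuous) on a zero-dimensional Polish space $X$ (zero-dimensional means that $X$ has a base consisting of clopen sets), and suppose that the action is $S$-free, i.e., $S \cap \mathrm{Stab}(x) \subseteq \{\mathbf 1\}$ for all $x \in X$. Let $X = C_0 \sqcup C \sqcup U$ be a partition of $X$ into (possibly empty) clopen sets such that - $C$ is $R$-syndetic, i.e., $R^{-1}\cdot C = X$; - $U$ is $S$-separated, i.e., there are no two distinct points $x, y \in U$ with $y = \sigma\cdot x$ for some $\sigma \in S \cup S^{-1}$. Then every continuous function $f_0 \colon C_0 \to \{0,1,\ldots,k-1\}$ (the target being discrete) can be extended to a continuous function $f \colon C_0 \sqcup C \to \{0,1,\ldots,k-1\}$ such that $$\forall x \in X\ \exists \sigma \in S:\quad \{\sigma\cdot x,\ \sigma\gamma\cdot x\} \subseteq C_0 \sqcup C \ \text{ and }\ f(\sigma\cdot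 x) \ne f(\sigma\gamma\cdot x).$$ -/

import Mathlib

open scoped Pointwise

namespace ContinuousCombinatorics

/-- A topological space is zero-dimensional if it has a base consisting of clopen sets. -/
def IsZeroDimensional (X : Type*) [TopologicalSpace X] : Prop :=
  TopologicalSpace.IsTopologicalBasis {V : Set X | IsClopen V}

/-- The action of `Γ` on `X` is `F`-free if `F ∩ Stab(x) ⊆ {1}` for every `x`. -/
def IsFreeOn {Γ : Type*} [Group Γ] (F : Set Γ) (X : Type*) [MulAction Γ X] : Prop :=
  ∀ x : X, F ∩ (MulAction.stabilizer Γ x : Set Γ) ⊆ {1}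

/-- The Schreier graph `G(X, F)`: two distinct points `x`, `y` are adjacent if and only if
`y = σ • x` for some `σ ∈ F ∪ F⁻¹`. -/
def schreierGraph {Γ : Type*} [Group Γ] (F : Set Γ) (X : Type*) [MulAction Γ X] :
    SimpleGraph X where
  Adj x y := x ≠ y ∧ ∃ σ ∈ F ∪ F⁻¹, y = σ • x
  symm := by
    constructor
    rintro x y ⟨hne, σ, hσ, rfl⟩
    refine ⟨hne.symm, σ⁻¹, ?_, by simp⟩
    rcases hσ with h | h
    · exact Or.inr (by simpa using h)
    · exact Or.inl (by simpa using h)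
  loopless := ⟨fun _ h => h.1 rfl⟩

/-- `A ⊆ X` is `S`-syndetic if `S⁻¹ • A = X`. -/
def IsSyndetic {Γ : Type*} [Group Γ] (S : Set Γ) {X : Type*} [MulAction Γ X]
    (A : Set X) : Prop :=
  S⁻¹ • A = Set.univ

/-- `A ⊆ X` is `S`-separated if it is independent in the Schreier graph `G(X, S)`. -/
def IsSeparated {Γ : Type*} [Group Γ] (S : Set Γ) {X : Type*} [MulAction Γ X]
    (A : Set X) : Prop :=
  (schreierGraph S X).IsIndepSet A

end ContinuousCombinatorics

namespace ContinuousCombinatorics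

/-! Choose a finite `W ⊆ Γ` meeting every `R`-syndetic set in at least `4t` elements, with `|W| ≤
4t|R|`. Markers form a maximal clopen `T`-separated set, `T = (W⁻¹W)²`, so the blocks `W • m` of
distinct markers are disjoint. Points of `C` in no block get colour 0. The blocks are coloured one
by one along a locally constant ranking.

Given `y`, take a marker `m = σ • y` with `σ ∈ T` and put `δ = σγσ⁻¹`. It suffices to find `α ∈ W`
such that `α • m` and `αδ • m` get different colours. At least `4t` of the points `α • m` lie in
`C`, and separation of `U` spoils at most one partner `αδ • m`. Either `2t` of the remaining pairs
are fully coloured once the block of `m` is, or `2t` partners lie in blocks of later markers. In the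
latter case separation of the markers makes all these blocks the same one, so those pairs are
completed when it is coloured (`exists_base_with_coloredPairs`).

A block therefore faces one constraint for each of polynomially many (in `t`) pairs `(μ, δ)`. A
constraint with `2t` pairs is violated by a fraction at most `k⁻ᵗ` of the block colourings. As `2ᵗ`
beats the polynomial, a union bound leaves a good colouring (`exists_overlay_ne`). The greedy
recursion along the ranking keeps every choice locally constant (`exists_greedy`). -/

/-! ### Counting colourings of one block. -/

/-- A family of functions in which the values on `Y` are determined by the values at points of
smaller rank has at most `k ^ (|ι| - |Y|)` members. -/
theorem card_mul_pow_le_of_determined {ι : Type*} [Fintype ι] [DecidableEq ι] {k : ℕ} (e : ι → ℕ)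
    (Y : Finset ι) (B : Finset (ι → Fin k))
    (hB : ∀ φ ∈ B, ∀ ψ ∈ B, ∀ z ∈ Y, (∀ w, e w < e z → φ w = ψ w) → φ z = ψ z) :
    B.card * k ^ Y.card ≤ k ^ Fintype.card ι := by
  have h1 : B.card ≤ k ^ (Yᶜ).card := by
    have : B.card ≤ (Finset.univ : Finset ((Yᶜ : Finset ι) → Fin k)).card := by
      refine Finset.card_le_card_of_injOn (fun φ z => φ z.1) (fun _ _ => Finset.mem_univ _) ?_
      intro φ hφ ψ hψ h
      have key : ∀ n, ∀ z, e z = n → φ z = ψ z := by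
        intro n
        induction n using Nat.strong_induction_on with
        | _ n ih =>
          intro z hz
          by_cases hzY : z ∈ Y
          · exact hB φ hφ ψ hψ z hzY fun w hw => ih _ (hz ▸ hw) w rfl
          · exact congrFun h ⟨z, Finset.mem_compl.2 hzY⟩
      exact funext fun z => key _ z rfl
    simpa [Finset.card_compl] using this
  calc B.card * k ^ Y.card ≤ k ^ (Yᶜ).card * k ^ Y.card := Nat.mul_le_mul_right _ h1
    _ = k ^ Fintype.card ι := by rw [← pow_add, Finset.card_compl_add_card]

/-- The partial colouring that uses `φ` on `Z` and `v` elsewhere. -/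
noncomputable def overlay {Γ A : Type*} (Z : Finset Γ) (v : Γ → Option A) (φ : Γ → A) (σ : Γ) :
    Option A :=
  open Classical in if σ ∈ Z then some (φ σ) else v σ

theorem overlay_of_mem {Γ A : Type*} {Z : Finset Γ} {v : Γ → Option A} {φ : Γ → A} {σ : Γ}
    (h : σ ∈ Z) : overlay Z v φ σ = some (φ σ) := by
  simp [overlay, h]

theorem overlay_of_notMem {Γ A : Type*} {Z : Finset Γ} {v : Γ → Option A} {φ : Γ → A} {σ : Γ}
    (h : σ ∉ Z) : overlay Z v φ σ = v σ := by
  simp [overlay, h]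

/-- Extend a function on a finite set to the whole type. -/
noncomputable def extendZero {Γ : Type*} {k : ℕ} [NeZero k] (Z : Finset Γ) (φ : Z → Fin k)
    (σ : Γ) : Fin k :=
  open Classical in if h : σ ∈ Z then φ ⟨σ, h⟩ else 0

theorem extendZero_of_mem {Γ : Type*} {k : ℕ} [NeZero k] {Z : Finset Γ} {φ : Z → Fin k}
    {σ : Γ} (h : σ ∈ Z) : extendZero Z φ σ = φ ⟨σ, h⟩ := by
  simp [extendZero, h]

/-- Each equation fixes the value at `p α` by a value that is either prescribed by `v` or sits at a
point of `Z` of smaller rank. Injectivity of `p` makes these `|I|` losses of freedom independent. -/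
theorem card_mul_pow_le_of_overlay_eq {Γ : Type*} [DecidableEq Γ] {k : ℕ} [NeZero k] (e : Γ → ℕ)
    (Z : Finset Γ) (v : Γ → Option (Fin k)) (p q : Γ → Γ) (hp : Function.Injective p)
    (I : Finset Γ) (hI : ∀ α ∈ I, p α ∈ Z ∧ (q α ∈ Z → e (q α) < e (p α)))
    (B : Finset (Z → Fin k))
    (hB : ∀ φ ∈ B, ∀ α ∈ I,
      overlay Z v (extendZero Z φ) (p α) = overlay Z v (extendZero Z φ) (q α)) :
    B.card * k ^ I.card ≤ k ^ Z.card := by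
  classical
  set Y : Finset Z := (I.attach.image fun α => (⟨p α.1, (hI α.1 α.2).1⟩ : Z)) with hY
  have hYc : Y.card = I.card := by
    rw [hY, Finset.card_image_of_injective, Finset.card_attach]
    intro a b hab
    exact Subtype.ext (hp (by simpa using hab))
  have := card_mul_pow_le_of_determined (fun z : Z => e z.1) Y B ?_
  · simpa [hYc] using this
  intro φ hφ ψ hψ z hz hlow
  obtain ⟨⟨α, hα⟩, -, rfl⟩ := Finset.mem_image.1 hz
  obtain ⟨hpZ, hq⟩ := hI α hα
  have h1 := hB φ hφ α hα
  have h2 := hB ψ hψ α hα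
  rw [overlay_of_mem hpZ, extendZero_of_mem hpZ] at h1 h2
  by_cases hqZ : q α ∈ Z
  · rw [overlay_of_mem hqZ, extendZero_of_mem hqZ] at h1 h2
    have h3 := hlow ⟨q α, hqZ⟩ (hq hqZ)
    rw [Option.some_inj] at h1 h2
    rw [h1, h2, h3]
  · rw [overlay_of_notMem hqZ] at h1 h2
    exact Option.some_injective _ (h1.trans h2.symm)

/-- The elements `α` of `W` for which the pair `(α * μ, α * δ * μ)` is coloured and
meets `Z`. -/
noncomputable def coloredPairs {Γ A : Type*} [Group Γ] (W Z : Finset Γ) (v : Γ → Option A)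
    (μ δ : Γ) : Finset Γ :=
  open Classical in W.filter fun α => (α * μ ∈ Z ∨ α * δ * μ ∈ Z) ∧
    (α * μ ∈ Z ∨ (v (α * μ)).isSome) ∧ (α * δ * μ ∈ Z ∨ (v (α * δ * μ)).isSome)

theorem mem_coloredPairs {Γ A : Type*} [Group Γ] {W Z : Finset Γ} {v : Γ → Option A}
    {μ δ α : Γ} :
    α ∈ coloredPairs W Z v μ δ ↔ α ∈ W ∧ (α * μ ∈ Z ∨ α * δ * μ ∈ Z) ∧
      (α * μ ∈ Z ∨ (v (α * μ)).isSome) ∧ (α * δ * μ ∈ Z ∨ (v (α * δ * μ)).isSome) :=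
  @Finset.mem_filter _ _ (_) _ _

/-- Union bound: each constraint with at least `2t` pairs excludes at most `k ^ (|Z| - t)`
colourings of `Z`, and there are fewer than `2 ^ t ≤ k ^ t` constraints. -/
theorem exists_overlay_ne {Γ : Type*} [Group Γ] [Countable Γ] {k : ℕ} (hk : 2 ≤ k) [NeZero k]
    (t : ℕ) (W Z : Finset Γ) (v : Γ → Option (Fin k)) (K : Finset (Γ × Γ))
    (hK : ∀ κ ∈ K, κ.2 ≠ 1) (hcard : K.card < 2 ^ t) :
    ∃ φ : Γ → Fin k, ∀ μ δ, (μ, δ) ∈ K → 2 * t ≤ (coloredPairs W Z v μ δ).card →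
      ∃ α ∈ W, ∃ a b, overlay Z v φ (α * μ) = some a ∧ overlay Z v φ (α * δ * μ) = some b ∧
        a ≠ b := by
  classical
  obtain ⟨e, he⟩ := exists_injective_nat Γ
  let K' := K.filter fun κ => 2 * t ≤ (coloredPairs W Z v κ.1 κ.2).card
  let B : Γ × Γ → Finset (Z → Fin k) := fun κ => Finset.univ.filter fun φ =>
    ∀ α ∈ coloredPairs W Z v κ.1 κ.2, overlay Z v (extendZero Z φ) (α * κ.1) =
      overlay Z v (extendZero Z φ) (α * κ.2 * κ.1)
  have hBc : ∀ κ ∈ K', (B κ).card * k ^ t ≤ k ^ Z.card := by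
    intro κ hκ
    obtain ⟨hκK, hκc⟩ := Finset.mem_filter.1 hκ
    set I := coloredPairs W Z v κ.1 κ.2 with hI
    have hI1 := card_mul_pow_le_of_overlay_eq e Z v (fun α => α * κ.1) (fun α => α * κ.2 * κ.1)
      (mul_left_injective _)
      (I.filter fun α => α * κ.1 ∈ Z ∧
        (α * κ.2 * κ.1 ∈ Z → e (α * κ.2 * κ.1) < e (α * κ.1)))
      (fun α hα => (Finset.mem_filter.1 hα).2) (B κ)
      (fun φ hφ α hα => (Finset.mem_filter.1 hφ).2 α (Finset.mem_filter.1 hα).1)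
    have hI2 := card_mul_pow_le_of_overlay_eq e Z v (fun α => α * κ.2 * κ.1) (fun α => α * κ.1)
      ((mul_left_injective κ.1).comp (mul_left_injective κ.2))
      (I.filter fun α => α * κ.2 * κ.1 ∈ Z ∧
        (α * κ.1 ∈ Z → e (α * κ.1) < e (α * κ.2 * κ.1)))
      (fun α hα => (Finset.mem_filter.1 hα).2) (B κ)
      (fun φ hφ α hα => ((Finset.mem_filter.1 hφ).2 α (Finset.mem_filter.1 hα).1).symm)
    set I1 := (I.filter fun α => α * κ.1 ∈ Z ∧
        (α * κ.2 * κ.1 ∈ Z → e (α * κ.2 * κ.1) < e (α * κ.1)))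
    set I2 := (I.filter fun α => α * κ.2 * κ.1 ∈ Z ∧
        (α * κ.1 ∈ Z → e (α * κ.1) < e (α * κ.2 * κ.1)))
    -- Each pair is charged to an end in `Z`, the one of larger rank if both are. Pairs charged to
    -- the same side have distinct charged ends, and one of the two sides receives at least `t` of
    -- the `2t` pairs.
    have hunion : I ⊆ I1 ∪ I2 := by
      intro α hα
      have hne : e (α * κ.1) ≠ e (α * κ.2 * κ.1) := by
        intro h
        have h := he h
        rw [mul_left_inj, eq_comm, mul_eq_left] at h
        exact hK κ hκK h
      have := (mem_coloredPairs.1 (hI ▸ hα)).2.1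
      simp only [Finset.mem_union, I1, I2, Finset.mem_filter]
      rcases lt_or_gt_of_ne hne with h | h <;> tauto
    have hc := (Finset.card_le_card hunion).trans (Finset.card_union_le _ _)
    have hk1 : 1 ≤ k := by omega
    rcases le_or_gt t I1.card with h | h
    · exact (Nat.mul_le_mul_left _ (Nat.pow_le_pow_right hk1 h)).trans hI1
    · have h : t ≤ I2.card := by omega
      exact (Nat.mul_le_mul_left _ (Nat.pow_le_pow_right hk1 h)).trans hI2
  have hlt : (K'.biUnion B).card < (Finset.univ : Finset (Z → Fin k)).card := by
    have hkt : 0 < k ^ t := by positivity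
    have hkZ : 0 < k ^ Z.card := by have : 0 < k := by omega
                                    positivity
    refine lt_of_mul_lt_mul_right (a := k ^ t) ?_ hkt.le
    calc (K'.biUnion B).card * k ^ t ≤ (∑ κ ∈ K', (B κ).card) * k ^ t :=
          Nat.mul_le_mul_right _ Finset.card_biUnion_le
      _ = ∑ κ ∈ K', (B κ).card * k ^ t := Finset.sum_mul _ _ _
      _ ≤ K'.card * k ^ Z.card := by
          simpa using Finset.sum_le_card_nsmul _ _ _ hBc
      _ ≤ K.card * k ^ Z.card := Nat.mul_le_mul_right _ (Finset.card_filter_le _ _)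
      _ < k ^ t * k ^ Z.card :=
          Nat.mul_lt_mul_of_pos_right (hcard.trans_le (Nat.pow_le_pow_left hk t)) hkZ
      _ = (Finset.univ : Finset (Z → Fin k)).card * k ^ t := by simp [mul_comm]
  obtain ⟨φ, -, hφ⟩ := Finset.exists_mem_notMem_of_card_lt_card hlt
  refine ⟨extendZero Z φ, fun μ δ hκ hc => ?_⟩
  have hκ' : (μ, δ) ∈ K' := Finset.mem_filter.2 ⟨hκ, hc⟩
  have : φ ∉ B (μ, δ) := fun h => hφ (Finset.mem_biUnion.2 ⟨_, hκ', h⟩)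
  simp only [B, Finset.mem_filter, Finset.mem_univ, true_and, not_forall] at this
  obtain ⟨α, hα, hne⟩ := this
  obtain ⟨hαW, -, h1, h2⟩ := mem_coloredPairs.1 hα
  have hsome : ∀ σ, (σ ∈ Z ∨ (v σ).isSome) → ∃ a, overlay Z v (extendZero Z φ) σ = some a := by
    intro σ hσ
    by_cases hZ : σ ∈ Z
    · exact ⟨_, overlay_of_mem hZ⟩
    · rw [overlay_of_notMem hZ]
      exact Option.isSome_iff_exists.1 (hσ.resolve_left hZ)
  obtain ⟨a, ha⟩ := hsome _ h1
  obtain ⟨b, hb⟩ := hsome _ h2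
  exact ⟨α, hαW, a, b, ha, hb, fun hab => hne (by rw [ha, hb, hab])⟩

/-! ### Choice of `W` and of the parameter `t`. -/

/-- There are finite sets of size `O(n)` that contain at least `n` elements of every
`R`-syndetic subset of an infinite group. -/
theorem exists_finset_meeting_syndetic {Γ : Type*} [Group Γ] [Infinite Γ] (R : Finset Γ) (n : ℕ) :
    ∃ W : Finset Γ, W.card ≤ n * R.card ∧
      ∀ P : Set Γ, (∀ β, ∃ ρ ∈ R, ρ * β ∈ P) → ∃ I ⊆ W, n ≤ I.card ∧ ∀ α ∈ I, α ∈ P := by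
  classical
  induction n with
  | zero => exact ⟨∅, by simp, fun P _ => ⟨∅, by simp⟩⟩
  | succ n ih =>
    obtain ⟨W, hW, hP⟩ := ih
    -- This `β` makes the translate `R * β` disjoint from `W`, so the element it contributes is new,
    -- at a cost of `|R|` per step.
    obtain ⟨β, hβ⟩ := Infinite.exists_notMem_finset (R⁻¹ * W)
    refine ⟨W ∪ R.image (· * β), ?_, fun P h => ?_⟩
    · refine (Finset.card_union_le _ _).trans ?_
      rw [add_mul, one_mul]
      exact add_le_add hW Finset.card_image_le
    · obtain ⟨I, hIW, hI, hIP⟩ := hP P h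
      obtain ⟨ρ, hρ, hρP⟩ := h β
      have hnot : ρ * β ∉ I := by
        intro hmem
        apply hβ
        have := Finset.mul_mem_mul (Finset.inv_mem_inv hρ) (hIW hmem)
        simpa using this
      refine ⟨insert (ρ * β) I, ?_, ?_, ?_⟩
      · intro α hα
        rcases Finset.mem_insert.1 hα with rfl | hα
        · exact Finset.mem_union_right _ (Finset.mem_image_of_mem _ hρ)
        · exact Finset.mem_union_left _ (hIW hα)
      · rw [Finset.card_insert_of_notMem hnot]; omega
      · intro α hα
        rcases Finset.mem_insert.1 hα with rfl | hα
        · exact hρP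
        · exact hIP α hα

/-- With `r = |R|`, the left side bounds `constraintSet` when `|W| ≤ 4 * t * r`; the linear size of
`W` is what makes the comparison with `2 ^ t` possible. -/
theorem exists_poly_lt_two_pow (r : ℕ) :
    ∃ t : ℕ, 1 ≤ t ∧ (4 * t * r) ^ 4 * ((4 * t * r) ^ 2 + 1) < 2 ^ t := by
  have h := tendsto_pow_const_div_const_pow_of_one_lt 6 (r := (2 : ℝ)) (by norm_num)
  have hc : (0 : ℝ) < 1 / (2 * (4 * (r + 1)) ^ 6) := by positivity
  obtain ⟨t, ht, ht1⟩ := ((h.eventually (gt_mem_nhds hc)).and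
    (Filter.eventually_ge_atTop 1)).exists
  refine ⟨t, ht1, ?_⟩
  have h2 : (0 : ℝ) < 2 ^ t := by positivity
  rw [div_lt_div_iff₀ h2 (by positivity)] at ht
  have h3 : t ^ 6 * (2 * (4 * (r + 1)) ^ 6) < 1 * 2 ^ t := by exact_mod_cast ht
  set N := 4 * t * (r + 1)
  have hN : 1 ≤ N := Nat.one_le_iff_ne_zero.2 (by positivity)
  have hle : 4 * t * r ≤ N := Nat.mul_le_mul_left _ (Nat.le_succ r)
  calc (4 * t * r) ^ 4 * ((4 * t * r) ^ 2 + 1) ≤ N ^ 4 * (N ^ 2 + N ^ 2) := by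
        gcongr; exact Nat.one_le_pow _ _ hN
    _ = t ^ 6 * (2 * (4 * (r + 1)) ^ 6) := by simp only [N]; ring
    _ < 2 ^ t := by simpa using h3

/-! ### Locally constant rankings, greedy recursion and markers. -/

/-- The values of `ℓ` at the translates of `x` by elements of `F`. -/
noncomputable def window {Γ X L : Type*} [SMul Γ X] (F : Finset Γ) (ℓ : X → L) (x : X) (σ : Γ) :
    Option L :=
  open Classical in if σ ∈ F then some (ℓ (σ • x)) else none

/-- The values of `g` at those translates of `x` by elements of `F` that precede `x`. -/
noncomputable def history {Γ X A : Type*} [SMul Γ X] (F : Finset Γ) (c : X → ℕ) (g : X → A)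
    (x : X) (σ : Γ) : Option A :=
  open Classical in if σ ∈ F ∧ c (σ • x) < c x then some (g (σ • x)) else none

theorem isLocallyConstant_iff {X Y : Type*} [TopologicalSpace X] {f : X → Y} :
    IsLocallyConstant f ↔ ∀ x, ∀ᶠ y in nhds x, f y = f x :=
  IsLocallyConstant.iff_eventually_eq f

theorem eventually_translates {Γ X Y : Type*} [Group Γ] [TopologicalSpace X] [MulAction Γ X]
    [ContinuousConstSMul Γ X] {ℓ : X → Y} (hℓ : IsLocallyConstant ℓ) (F : Finset Γ) (x : X) :
    ∀ᶠ y in nhds x, ∀ σ ∈ F, ℓ (σ • y) = ℓ (σ • x) := by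
  rw [Filter.eventually_all_finset]
  intro σ _
  exact ((continuous_const_smul σ).tendsto x).eventually (isLocallyConstant_iff.1 hℓ (σ • x))

/-- Greedy constructions along a locally constant ranking yield locally constant functions. -/
theorem exists_greedy {Γ X L A : Type*} [Group Γ] [TopologicalSpace X] [MulAction Γ X]
    [ContinuousConstSMul Γ X] (F : Finset Γ) {ℓ : X → L} (hℓ : IsLocallyConstant ℓ) {c : X → ℕ}
    (hc : IsLocallyConstant c) (Ψ : (Γ → Option L) → (Γ → Option A) → A) :
    ∃ g : X → A, IsLocallyConstant g ∧ ∀ x, g x = Ψ (window F ℓ x) (history F c g x) := by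
  classical
  let G : X → A := (measure c).wf.fix fun x rec => Ψ (window F ℓ x) fun σ =>
    if h : σ ∈ F ∧ c (σ • x) < c x then some (rec (σ • x) h.2) else none
  have hG : ∀ x, G x = Ψ (window F ℓ x) (history F c G x) := by
    intro x
    simp only [G]
    rw [WellFounded.fix_eq]
    congr 1
  refine ⟨G, isLocallyConstant_iff.2 ?_, hG⟩
  have key : ∀ n x, c x = n → ∀ᶠ y in nhds x, G y = G x := by
    intro n
    induction n using Nat.strong_induction_on with
    | _ n ih =>
      intro x hx
      -- The recursion at `x` reads finitely many values, all at points of smaller rank, where `G`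
      -- is already known to be locally constant.
      have h1 : ∀ᶠ y in nhds x, ∀ σ ∈ F, c (σ • x) < c x → G (σ • y) = G (σ • x) := by
        rw [Filter.eventually_all_finset]
        intro σ _
        by_cases hlt : c (σ • x) < c x
        · filter_upwards [((continuous_const_smul σ).tendsto x).eventually
            (ih _ (hx ▸ hlt) (σ • x) rfl)] with y hy _ using hy
        · exact Filter.Eventually.of_forall fun y h => absurd h hlt
      filter_upwards [h1, isLocallyConstant_iff.1 hc x, eventually_translates hc F x,
        eventually_translates hℓ F x] with y hy1 hy2 hy3 hy4
      rw [hG y, hG x]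
      congr 1
      · funext σ
        by_cases hσ : σ ∈ F
        · simp [window, hσ, hy4 σ hσ]
        · simp [window, hσ]
      · funext σ
        by_cases hσ : σ ∈ F
        · by_cases hlt : c (σ • x) < c x
          · simp [history, hσ, hy2, hy3 σ hσ, hlt, hy1 σ hσ hlt]
          · simp [history, hσ, hy2, hy3 σ hσ, hlt]
        · simp [history, hσ]
  exact fun x => key _ x rfl

theorem smul_ne_of_isFreeOn {Γ X : Type*} [Group Γ] [MulAction Γ X] {F : Set Γ}
    (h : IsFreeOn F X) {σ : Γ} (hσ : σ ∈ F) (x : X) (hx : σ • x = x) : σ = 1 :=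
  h x ⟨hσ, hx⟩

/-- By freeness every point has a clopen neighbourhood disjoint from its translates by the
nontrivial elements of `F`. Countably many of these cover `X`, and the rank of a point is the first
index of a set containing it; clopenness makes this index locally constant. -/
theorem exists_proper_ranking {Γ X : Type*} [Group Γ] [TopologicalSpace X] [T2Space X]
    [SecondCountableTopology X] [MulAction Γ X] [ContinuousConstSMul Γ X]
    (hX : IsZeroDimensional X) (F : Finset Γ) (hF : IsFreeOn (F : Set Γ) X) :
    ∃ c : X → ℕ, IsLocallyConstant c ∧ ∀ σ ∈ F, ∀ x : X, c (σ • x) = c x → σ = 1 := by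
  classical
  have hV : ∀ x : X, ∃ V : Set X, IsClopen V ∧ x ∈ V ∧
      ∀ σ ∈ F, ∀ y ∈ V, σ • y ∈ V → σ = 1 := by
    intro x
    have h1 : ∀ σ ∈ F, ∃ V : Set X, IsOpen V ∧ x ∈ V ∧ ∀ y ∈ V, σ • y ∈ V → σ = 1 := by
      intro σ hσ
      by_cases h : σ = 1
      · exact ⟨Set.univ, isOpen_univ, trivial, fun _ _ _ => h⟩
      · obtain ⟨A, B, hA, hB, hxA, hxB, hAB⟩ :=
          t2_separation (fun hx : σ • x = x => h (smul_ne_of_isFreeOn hF hσ x hx))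
        refine ⟨B ∩ (σ • ·) ⁻¹' A, hB.inter (hA.preimage (continuous_const_smul σ)),
          ⟨hxB, hxA⟩, fun y hy hy' => ?_⟩
        exact absurd hy'.1 (Set.disjoint_left.1 hAB hy.2)
    choose! V hVo hVx hVs using h1
    have hopen : IsOpen (⋂ σ ∈ F, V σ) := isOpen_biInter_finset hVo
    obtain ⟨C, hC, hxC, hCV⟩ := hX.exists_subset_of_mem_open
      (Set.mem_iInter₂.2 hVx) hopen
    exact ⟨C, hC, hxC, fun σ hσ y hy hy' =>
      hVs σ hσ y (Set.mem_iInter₂.1 (hCV hy) σ hσ) (Set.mem_iInter₂.1 (hCV hy') σ hσ)⟩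
  choose V hVc hVx hVs using hV
  rcases isEmpty_or_nonempty X with hemp | hne
  · exact ⟨fun _ => 0, IsLocallyConstant.const 0, fun _ _ x => hemp.elim x⟩
  obtain ⟨s, hs, hcov⟩ := TopologicalSpace.countable_cover_nhds
    (fun x => (hVc x).isOpen.mem_nhds (hVx x))
  have hsne : s.Nonempty := by
    obtain ⟨x⟩ := hne
    have : x ∈ ⋃ y ∈ s, V y := hcov ▸ Set.mem_univ x
    obtain ⟨y, hy, -⟩ := Set.mem_iUnion₂.1 this
    exact ⟨y, hy⟩
  obtain ⟨p, hp⟩ := hs.exists_eq_range hsne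
  have hex : ∀ x, ∃ n, x ∈ V (p n) := by
    intro x
    have : x ∈ ⋃ y ∈ s, V y := hcov ▸ Set.mem_univ x
    obtain ⟨y, hy, hxy⟩ := Set.mem_iUnion₂.1 this
    rw [hp] at hy
    obtain ⟨n, rfl⟩ := hy
    exact ⟨n, hxy⟩
  refine ⟨fun x => Nat.find (hex x), isLocallyConstant_iff.2 fun x => ?_, fun σ hσ x hx => ?_⟩
  · have h1 : ∀ᶠ y in nhds x, ∀ n ∈ Finset.range (Nat.find (hex x)), y ∉ V (p n) := by
      rw [Filter.eventually_all_finset]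
      intro n hn
      exact (hVc (p n)).compl.isOpen.mem_nhds (Nat.find_min (hex x) (Finset.mem_range.1 hn))
    filter_upwards [h1, (hVc _).isOpen.mem_nhds (Nat.find_spec (hex x))] with y hy1 hy2
    exact (Nat.find_eq_iff _).2 ⟨hy2, fun n hn => hy1 n (Finset.mem_range.2 hn)⟩
  · have h1 := Nat.find_spec (hex (σ • x))
    have h2 := Nat.find_spec (hex x)
    simp only at hx
    rw [hx] at h1
    exact hVs _ σ hσ x h2 h1

/-- A maximal `T`-separated clopen set. -/
theorem exists_maximal_separated {Γ X : Type*} [Group Γ] [TopologicalSpace X]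
    [MulAction Γ X] [ContinuousConstSMul Γ X] (T : Finset Γ) (hT1 : 1 ∈ T)
    (hT : ∀ σ ∈ T, σ⁻¹ ∈ T) {c : X → ℕ} (hc : IsLocallyConstant c)
    (hcT : ∀ σ ∈ T, ∀ x : X, c (σ • x) = c x → σ = 1) :
    ∃ M : X → Prop, IsLocallyConstant M ∧ (∀ σ ∈ T, ∀ x, M x → M (σ • x) → σ = 1) ∧
      ∀ x, ∃ σ ∈ T, M (σ • x) := by
  classical
  obtain ⟨M, hM, hMx⟩ := exists_greedy (A := Prop) T (IsLocallyConstant.const (X := X) ()) hc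
    (fun _ h => ∀ σ, h σ ≠ some True)
  have hM' : ∀ x, M x ↔ ∀ σ ∈ T, c (σ • x) < c x → ¬ M (σ • x) := by
    intro x
    conv_lhs => rw [hMx x]
    refine forall_congr' fun σ => ?_
    by_cases hσ : σ ∈ T <;> by_cases hlt : c (σ • x) < c x <;> simp [history, hσ, hlt]
  refine ⟨M, hM, fun σ hσ x hx hσx => ?_, fun x => ?_⟩
  · rcases lt_trichotomy (c (σ • x)) (c x) with h | h | h
    · exact absurd hσx ((hM' x).1 hx σ hσ h)
    · exact hcT σ hσ x h
    · have := (hM' _).1 hσx σ⁻¹ (hT σ hσ)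
      rw [inv_smul_smul] at this
      exact absurd hx (this h)
  · by_cases hx : M x
    · exact ⟨1, hT1, by simpa using hx⟩
    · rw [hM'] at hx
      push Not at hx
      obtain ⟨σ, hσ, -, h⟩ := hx
      exact ⟨σ, hσ, h⟩

end ContinuousCombinatorics

namespace ContinuousCombinatorics

/-! ### Labels, blocks and the colouring assembled from them. -/

/-- Some element satisfying `P`, if there is one. -/
noncomputable def someWitness {Γ : Type*} (P : Γ → Prop) : Option Γ :=
  open Classical in if h : ∃ w, P w then some h.choose else none

theorem someWitness_spec {Γ : Type*} {P : Γ → Prop} {w : Γ} (h : someWitness P = some w) :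
    P w := by
  unfold someWitness at h
  split_ifs at h with h1
  · rw [Option.some_inj] at h
    exact h ▸ h1.choose_spec

theorem someWitness_eq {Γ : Type*} {P : Γ → Prop} {w : Γ} (hw : P w)
    (huniq : ∀ w', P w' → w' = w) : someWitness P = some w := by
  have h1 : ∃ w, P w := ⟨w, hw⟩
  rw [someWitness, dif_pos h1, huniq _ h1.choose_spec]

/-- The label of a point: `none` outside `C₀ ∪ C`; `inl a` if its colour is fixed to be `a`;
`inr w` if it is the point of `C` with coordinate `w` in the block `W • m` of a marker `m`. -/
noncomputable def pointLabel {Γ X : Type*} [Group Γ] [MulAction Γ X] {k : ℕ} [NeZero k]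
    (W : Finset Γ) (M : X → Prop) (C₀ C : Set X) (f₀ : X → Fin k) (y : X) :
    Option (Fin k ⊕ Γ) :=
  open Classical in
  if y ∈ C₀ then some (.inl (f₀ y))
  else if y ∈ C then
    some ((someWitness fun w => w ∈ W ∧ M (w⁻¹ • y)).elim (.inl 0) .inr)
  else none

section pointLabel

variable {Γ X : Type*} [Group Γ] [MulAction Γ X] {k : ℕ} [NeZero k]
    {W : Finset Γ} {M : X → Prop} {C₀ C : Set X} {f₀ : X → Fin k} {y : X}

theorem pointLabel_eq_none_iff : pointLabel W M C₀ C f₀ y = none ↔ y ∉ C₀ ∪ C := by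
  unfold pointLabel
  split_ifs with h1 h2 <;> simp [h1]
  · exact h2
  · exact h2

theorem pointLabel_of_mem (h : y ∈ C₀) : pointLabel W M C₀ C f₀ y = some (.inl (f₀ y)) := by
  simp [pointLabel, h]

theorem pointLabel_eq_inr {w : Γ} (h : pointLabel W M C₀ C f₀ y = some (.inr w)) :
    w ∈ W ∧ M (w⁻¹ • y) := by
  unfold pointLabel at h
  split_ifs at h with h1 h2
  · simp at h
  · rw [Option.some_inj] at h
    cases hs : someWitness fun w => w ∈ W ∧ M (w⁻¹ • y) with
    | none => simp [hs] at h
    | some v =>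
      rw [hs] at h
      simp only [Option.elim_some, Sum.inr.injEq] at h
      exact h ▸ someWitness_spec (P := fun w => w ∈ W ∧ M (w⁻¹ • y)) hs

theorem pointLabel_of_owner (h0 : y ∉ C₀) (hC : y ∈ C) {w : Γ} (hw : w ∈ W) (hM : M (w⁻¹ • y))
    (huniq : ∀ w' ∈ W, M (w'⁻¹ • y) → w' = w) :
    pointLabel W M C₀ C f₀ y = some (.inr w) := by
  rw [pointLabel, if_neg h0, if_pos hC,
    someWitness_eq (P := fun w => w ∈ W ∧ M (w⁻¹ • y)) ⟨hw, hM⟩ fun w' h => huniq w' h.1 h.2]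
  rfl

theorem isLocallyConstant_pointLabel [TopologicalSpace X] [ContinuousConstSMul Γ X]
    (hM : IsLocallyConstant M) (hC₀ : IsClopen C₀) (hC : IsClopen C)
    (hf₀ : IsLocallyConstant f₀) : IsLocallyConstant (pointLabel W M C₀ C f₀) := by
  classical
  have hmem : ∀ {V : Set X}, IsClopen V → ∀ x, ∀ᶠ y in nhds x, (y ∈ V) = (x ∈ V) := by
    intro V hV x
    by_cases hx : x ∈ V
    · filter_upwards [hV.isOpen.mem_nhds hx] with y hy using by simp [hx, hy]
    · filter_upwards [hV.compl.isOpen.mem_nhds hx] with y hy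
      have : y ∉ V := hy
      simp [hx, this]
  refine isLocallyConstant_iff.2 fun x => ?_
  filter_upwards [hmem hC₀ x, hmem hC x, isLocallyConstant_iff.1 hf₀ x,
    eventually_translates hM W⁻¹ x] with y h1 h2 h3 h4
  have h5 : (fun w => w ∈ W ∧ M (w⁻¹ • y)) = fun w => w ∈ W ∧ M (w⁻¹ • x) := by
    funext w
    by_cases hw : w ∈ W
    · rw [h4 _ (Finset.inv_mem_inv hw)]
    · simp [hw]
  simp only [pointLabel, h1, h2, h3, h5]

end pointLabel

/-- The positions in `W` owned by the base point of a window. -/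
noncomputable def ownedPositions {Γ A : Type*} (W : Finset Γ)
    (L : Γ → Option (Option (A ⊕ Γ))) : Finset Γ :=
  open Classical in W.filter fun σ => L σ = some (some (.inr σ))

theorem mem_ownedPositions {Γ X A : Type*} [SMul Γ X] {lab : X → Option (A ⊕ Γ)}
    {W F : Finset Γ} {x : X} {σ : Γ} (hσF : σ ∈ F) :
    σ ∈ ownedPositions W (window F lab x) ↔ σ ∈ W ∧ lab (σ • x) = some (.inr σ) := by
  refine (@Finset.mem_filter _ _ (_) _ _).trans ?_
  rw [window, if_pos hσF, Option.some_inj]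

/-- The colours visible in a window with labels `L` once the colours `h` of the blocks of some
markers have been chosen. -/
def visibleColor {Γ A : Type*} [Group Γ] (L : Γ → Option (Option (A ⊕ Γ)))
    (h : Γ → Option (Γ → A)) (σ : Γ) : Option A :=
  match L σ with
  | some (some (.inl a)) => some a
  | some (some (.inr w)) => (h (w⁻¹ * σ)).map fun φ => φ w
  | _ => none

/-- The colouring of all points determined by the colourings `g m` of the blocks of markers. -/
def blockColoring {Γ X : Type*} [Group Γ] [MulAction Γ X] {k : ℕ} [NeZero k]
    (lab : X → Option (Fin k ⊕ Γ)) (g : X → Γ → Fin k) (y : X) : Fin k :=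
  match lab y with
  | some (.inl a) => a
  | some (.inr w) => g (w⁻¹ • y) w
  | none => 0

section blockColoring

variable {Γ X : Type*} [Group Γ] [MulAction Γ X] {k : ℕ} [NeZero k]
    {lab : X → Option (Fin k ⊕ Γ)} {g : X → Γ → Fin k}

theorem isLocallyConstant_blockColoring [TopologicalSpace X] [ContinuousConstSMul Γ X]
    (hlab : IsLocallyConstant lab) (hg : IsLocallyConstant g) :
    IsLocallyConstant (blockColoring lab g) := by
  refine isLocallyConstant_iff.2 fun x => ?_
  have h2 : ∀ᶠ y in nhds x, ∀ w, lab x = some (.inr w) → g (w⁻¹ • y) = g (w⁻¹ • x) := by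
    rcases hx : lab x with _ | (a | w)
    · simp
    · simp
    · filter_upwards [eventually_translates hg {w⁻¹} x] with y hy v hv
      simp only [Option.some_inj, Sum.inr.injEq] at hv
      subst hv
      exact hy _ (Finset.mem_singleton_self _)
  filter_upwards [isLocallyConstant_iff.1 hlab x, h2] with y hy1 hy2
  unfold blockColoring
  rw [hy1]
  rcases hx : lab x with _ | (a | w)
  · rfl
  · rfl
  · simp only [hy2 w hx]

/-- What is visible when `g x` is chosen agrees with the final colouring, since colours of earlier
blocks are never revised. Hence a constraint satisfied at `x` stays satisfied. -/
theorem blockColoring_of_overlay {W F : Finset Γ} {c : X → ℕ} {x : X} {σ : Γ} (hσF : σ ∈ F)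
    {b : Fin k}
    (h : overlay (ownedPositions W (window F lab x))
      (visibleColor (window F lab x) (history F c g x)) (g x) σ = some b) :
    lab (σ • x) ≠ none ∧ blockColoring lab g (σ • x) = b := by
  have hwin : window F lab x σ = some (lab (σ • x)) := by simp [window, hσF]
  by_cases hZ : σ ∈ ownedPositions W (window F lab x)
  · rw [overlay_of_mem hZ, Option.some_inj] at h
    have := ((mem_ownedPositions hσF).1 hZ).2
    simp [blockColoring, this, h]
  · rw [overlay_of_notMem hZ, visibleColor, hwin] at h
    rcases hl : lab (σ • x) with _ | (a | w)
    · simp [hl] at h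
    · simpa [hl, blockColoring] using h
    · simp only [hl, Option.map_eq_some_iff] at h
      obtain ⟨φ, hφ, hb⟩ := h
      unfold history at hφ
      split_ifs at hφ with hh
      rw [Option.some_inj] at hφ
      simp [blockColoring, hl, ← hb, ← hφ, mul_smul]

end blockColoring

/-! ### The finite sets of group elements and their sizes. -/

section words

variable {Γ : Type*} [Group Γ] [DecidableEq Γ]

/-- The differences of differences of `W`. -/
def doubleDiff (W : Finset Γ) : Finset Γ := (W⁻¹ * W) * (W⁻¹ * W)

/-- The pairs `(μ, δ)` such that the orbit edges at `μ • x` shifted by `δ` may have to be taken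
care of at the marker `x`. -/
def constraintSet (γ : Γ) (W T : Finset Γ) : Finset (Γ × Γ) :=
  T.image (fun τ => (1, τ⁻¹ * γ * τ)) ∪
    (T ×ˢ (W⁻¹ * W)).image
      (fun p => ((p.2 * (p.1⁻¹ * γ * p.1))⁻¹, p.1⁻¹ * γ * p.1))

/-- The group elements that translate a marker to the points relevant to its block. -/
def windowSet (W T : Finset Γ) (K : Finset (Γ × Γ)) : Finset Γ :=
  T ∪ K.image Prod.fst ∪ W * K.image Prod.fst ∪ W * K.image Prod.snd * K.image Prod.fst ∪
    W⁻¹ * W * K.image Prod.snd * K.image Prod.fst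

theorem mem_doubleDiff {W : Finset Γ} {a b d e : Γ} (ha : a ∈ W) (hb : b ∈ W) (hd : d ∈ W)
    (he : e ∈ W) : a⁻¹ * b * (d⁻¹ * e) ∈ doubleDiff W :=
  Finset.mul_mem_mul (Finset.mul_mem_mul (Finset.inv_mem_inv ha) hb)
    (Finset.mul_mem_mul (Finset.inv_mem_inv hd) he)

theorem diff_mem_doubleDiff {W : Finset Γ} {a b : Γ} (ha : a ∈ W) (hb : b ∈ W) :
    a⁻¹ * b ∈ doubleDiff W := by
  simpa using mem_doubleDiff ha hb hb hb

theorem inv_mem_doubleDiff {W : Finset Γ} {σ : Γ} (h : σ ∈ doubleDiff W) :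
    σ⁻¹ ∈ doubleDiff W := by
  have : (doubleDiff W)⁻¹ = doubleDiff W := by simp [doubleDiff, mul_inv_rev]
  rw [← this]
  exact Finset.inv_mem_inv h

theorem card_doubleDiff_le (W : Finset Γ) : (doubleDiff W).card ≤ W.card ^ 4 := by
  have h : (W⁻¹ * W).card ≤ W.card * W.card := by
    simpa using Finset.card_mul_le (s := W⁻¹) (t := W)
  calc (doubleDiff W).card ≤ (W⁻¹ * W).card * (W⁻¹ * W).card := Finset.card_mul_le
    _ ≤ (W.card * W.card) * (W.card * W.card) := Nat.mul_le_mul h h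
    _ = W.card ^ 4 := by ring

theorem card_constraintSet_le (γ : Γ) (W : Finset Γ) :
    (constraintSet γ W (doubleDiff W)).card ≤ W.card ^ 4 * (W.card ^ 2 + 1) := by
  have h : (W⁻¹ * W).card ≤ W.card * W.card := by
    simpa using Finset.card_mul_le (s := W⁻¹) (t := W)
  have h4 := card_doubleDiff_le W
  calc (constraintSet γ W (doubleDiff W)).card
      ≤ (doubleDiff W).card + (doubleDiff W ×ˢ (W⁻¹ * W)).card :=
        (Finset.card_union_le _ _).trans (add_le_add Finset.card_image_le Finset.card_image_le)
    _ = (doubleDiff W).card * ((W⁻¹ * W).card + 1) := by rw [Finset.card_product]; ring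
    _ ≤ W.card ^ 4 * (W.card * W.card + 1) :=
        Nat.mul_le_mul h4 (Nat.add_le_add_right h 1)
    _ = W.card ^ 4 * (W.card ^ 2 + 1) := by ring

theorem one_conj_mem_constraintSet {γ τ : Γ} {W T : Finset Γ} (hτ : τ ∈ T) :
    (1, τ⁻¹ * γ * τ) ∈ constraintSet γ W T :=
  Finset.mem_union_left _ (Finset.mem_image_of_mem _ hτ)

theorem inv_conj_mem_constraintSet {γ τ w α : Γ} {W T : Finset Γ} (hτ : τ ∈ T) (hw : w ∈ W)
    (hα : α ∈ W) :
    ((w⁻¹ * α * (τ⁻¹ * γ * τ))⁻¹, τ⁻¹ * γ * τ) ∈ constraintSet γ W T := by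
  refine Finset.mem_union_right _ (Finset.mem_image.2 ⟨(τ, w⁻¹ * α), ?_, rfl⟩)
  exact Finset.mem_product.2 ⟨hτ, Finset.mul_mem_mul (Finset.inv_mem_inv hw) hα⟩

theorem ne_one_of_mem_constraintSet {γ : Γ} (hγ : γ ≠ 1) {W T : Finset Γ} {κ : Γ × Γ}
    (h : κ ∈ constraintSet γ W T) : κ.2 ≠ 1 := by
  have key : ∀ τ : Γ, τ⁻¹ * γ * τ ≠ 1 := by
    intro τ hτ
    apply hγ
    have : γ = τ * (τ⁻¹ * γ * τ) * τ⁻¹ := by group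
    rw [this, hτ]
    group
  rcases Finset.mem_union.1 h with h | h
  · obtain ⟨τ, -, rfl⟩ := Finset.mem_image.1 h
    exact key τ
  · obtain ⟨p, -, rfl⟩ := Finset.mem_image.1 h
    exact key _

variable {W T : Finset Γ} {K : Finset (Γ × Γ)} {μ δ α w : Γ}

theorem subset_windowSet : T ⊆ windowSet W T K := fun σ h => by
  simp only [windowSet, Finset.mem_union]; tauto

theorem fst_mem_windowSet (h : (μ, δ) ∈ K) : μ ∈ windowSet W T K := by
  have : μ ∈ K.image Prod.fst := Finset.mem_image.2 ⟨_, h, rfl⟩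
  simp only [windowSet, Finset.mem_union]; tauto

theorem mul_fst_mem_windowSet (h : (μ, δ) ∈ K) (hα : α ∈ W) : α * μ ∈ windowSet W T K := by
  have := Finset.mul_mem_mul hα (Finset.mem_image.2 ⟨_, h, rfl⟩ : μ ∈ K.image Prod.fst)
  simp only [windowSet, Finset.mem_union]; tauto

theorem mul_snd_mul_fst_mem_windowSet (h : (μ, δ) ∈ K) (hα : α ∈ W) :
    α * δ * μ ∈ windowSet W T K := by
  have := Finset.mul_mem_mul
    (Finset.mul_mem_mul hα (Finset.mem_image.2 ⟨_, h, rfl⟩ : δ ∈ K.image Prod.snd))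
    (Finset.mem_image.2 ⟨_, h, rfl⟩ : μ ∈ K.image Prod.fst)
  simp only [windowSet, Finset.mem_union]; tauto

theorem diff_mul_mem_windowSet (h : (μ, δ) ∈ K) (hw : w ∈ W) (hα : α ∈ W) :
    w⁻¹ * α * δ * μ ∈ windowSet W T K := by
  have := Finset.mul_mem_mul (Finset.mul_mem_mul
    (Finset.mul_mem_mul (Finset.inv_mem_inv hw) hα)
    (Finset.mem_image.2 ⟨_, h, rfl⟩ : δ ∈ K.image Prod.snd))
    (Finset.mem_image.2 ⟨_, h, rfl⟩ : μ ∈ K.image Prod.fst)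
  simp only [windowSet, Finset.mem_union]; tauto

end words

end ContinuousCombinatorics

namespace ContinuousCombinatorics

/-! ### Where each constraint is met, and the final assembly. -/

/-- At every pair `(m, δ)` there are at least `n` coloured pairs visible at `m` or at the only
other marker whose block meets `W * δ • m`. -/
theorem exists_base_with_coloredPairs {Γ X : Type*} [Group Γ] [DecidableEq Γ] [MulAction Γ X]
    {k : ℕ} [NeZero k] {γ : Γ} {W F : Finset Γ} {S : Set Γ} {c : X → ℕ} {M : X → Prop}
    {C₀ C U : Set X} {f₀ : X → Fin k} {n : ℕ}
    (hn : 1 ≤ n)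
    (hF : F = windowSet W (doubleDiff W) (constraintSet γ W (doubleDiff W)))
    (hFS : (F : Set Γ) ⊆ S) (hWS : ∀ α ∈ W, ∀ β ∈ W, α * β⁻¹ ∈ S)
    (hfree : IsFreeOn S X)
    (hc : ∀ σ ∈ F, ∀ x : X, c (σ • x) = c x → σ = 1)
    (hM : ∀ σ ∈ doubleDiff W, ∀ x, M x → M (σ • x) → σ = 1)
    (hdisj : Disjoint C₀ C) (hcover : C₀ ∪ C ∪ U = Set.univ) (hU : IsSeparated S U)
    (m : X) (hm : M m) {τ : Γ} (hτ : τ ∈ doubleDiff W)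
    (I : Finset Γ) (hIW : I ⊆ W) (hIc : 2 * n ≤ I.card) (hIC : ∀ α ∈ I, α • m ∈ C)
    (g : X → Γ → Fin k) :
    ∃ (x : X) (μ : Γ), (μ, τ⁻¹ * γ * τ) ∈ constraintSet γ W (doubleDiff W) ∧ m = μ • x ∧
      n ≤ (coloredPairs W (ownedPositions W (window F (pointLabel W M C₀ C f₀) x))
        (visibleColor (window F (pointLabel W M C₀ C f₀) x) (history F c g x)) μ
        (τ⁻¹ * γ * τ)).card := by
  classical
  set lab := pointLabel W M C₀ C f₀ with hlab
  set K := constraintSet γ W (doubleDiff W) with hK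
  set δ := τ⁻¹ * γ * τ with hδ
  have h1K : (1, δ) ∈ K := one_conj_mem_constraintSet hτ
  have hfreeF : ∀ σ ∈ F, ∀ x : X, σ • x = x → σ = 1 := fun σ hσ x hx =>
    smul_ne_of_isFreeOn hfree (hFS hσ) x hx
  have hlabC : ∀ α ∈ I, lab (α • m) = some (.inr α) := by
    intro α hα
    refine pointLabel_of_owner (Set.disjoint_right.1 hdisj (hIC α hα)) (hIC α hα) (hIW hα)
      (by simpa using hm) fun w hw hMw => ?_
    have := hM (w⁻¹ * α) (diff_mem_doubleDiff hw (hIW hα)) m hm (by rwa [mul_smul])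
    exact (inv_mul_eq_one.1 this)
  -- Two such points differ by `α * β⁻¹ ∈ S`, so separation of `U` makes them equal, and freeness
  -- then gives `α = β`.
  have hsub1 : (I.filter fun α => (α * δ) • m ∈ U).card ≤ 1 := by
    rw [Finset.card_le_one]
    intro α hα β hβ
    obtain ⟨hαI, hα⟩ := Finset.mem_filter.1 hα
    obtain ⟨hβI, hβ⟩ := Finset.mem_filter.1 hβ
    have hmem := hWS α (hIW hαI) β (hIW hβI)
    have heq : (α * δ) • m = (α * β⁻¹) • (β * δ) • m := by
      rw [← mul_smul]; congr 1; group
    by_cases hne : (β * δ) • m = (α * δ) • m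
    · rw [← hne] at heq
      exact mul_inv_eq_one.1 (smul_ne_of_isFreeOn hfree hmem _ heq.symm)
    · exact absurd ⟨hne, α * β⁻¹, Or.inl hmem, heq⟩ (hU hβ hα hne)
  set I' := I \ I.filter fun α => (α * δ) • m ∈ U
  have hI'c : 2 * n - 1 ≤ I'.card := by
    have : I.card - _ ≤ I'.card :=
      Finset.le_card_sdiff (I.filter fun α => (α * δ) • m ∈ U) I
    omega
  have hI'I : ∀ α ∈ I', α ∈ I := fun α hα => (Finset.mem_sdiff.1 hα).1
  have hlabδ : ∀ α ∈ I', lab ((α * δ) • m) ≠ none := by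
    intro α hα h
    have h1 := pointLabel_eq_none_iff.1 h
    have h2 : (α * δ) • m ∈ C₀ ∪ C ∪ U := hcover ▸ Set.mem_univ _
    exact h2.elim h1 fun hmU =>
      (Finset.mem_sdiff.1 hα).2 (Finset.mem_filter.2 ⟨hI'I α hα, hmU⟩)
  let later : Γ → Prop := fun α => ∃ w, lab ((α * δ) • m) = some (.inr w) ∧
    c m < c (w⁻¹ • (α * δ) • m)
  have hsplit := Finset.card_filter_add_card_filter_not (s := I') later
  -- Since `I'` has at least `2 * n - 1` elements, one of the two classes has at least `n`.
  rcases lt_or_ge (I'.filter fun α => ¬ later α).card n with hlt | hge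
  · have hJ : n ≤ (I'.filter later).card := by omega
    obtain ⟨α₀, hα₀⟩ := Finset.card_pos.1 (lt_of_lt_of_le hn hJ)
    obtain ⟨hα₀I', w₀, hw₀, hcw₀⟩ := Finset.mem_filter.1 hα₀
    obtain ⟨hw₀W, hw₀M⟩ := pointLabel_eq_inr hw₀
    have hα₀W := hIW (hI'I _ hα₀I')
    set ν := w₀⁻¹ * α₀ * δ with hν
    have hμK : (ν⁻¹, δ) ∈ K := inv_conj_mem_constraintSet hτ hw₀W hα₀W
    have hx : w₀⁻¹ • (α₀ * δ) • m = ν • m := by rw [← mul_smul, hν, mul_assoc]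
    rw [hx] at hcw₀ hw₀M
    have hmx : m = ν⁻¹ • ν • m := by simp
    have hνx : ∀ σ : Γ, (σ * ν⁻¹) • ν • m = σ • m := fun σ => by rw [mul_smul, ← hmx]
    refine ⟨ν • m, ν⁻¹, hμK, hmx, hJ.trans (Finset.card_le_card fun α hα => ?_)⟩
    obtain ⟨hαI', w, hw, hcw⟩ := Finset.mem_filter.1 hα
    have hαI := hI'I _ hαI'
    have hαW := hIW hαI
    obtain ⟨hwW, hwM⟩ := pointLabel_eq_inr hw
    -- The owners of two later partners differ by an element of `doubleDiff W`, so they coincide;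
    -- this is why markers are separated by double differences.
    have hratio : (w⁻¹ * α * (α₀⁻¹ * w₀)) • ν • m = w⁻¹ • (α * δ) • m := by
      rw [← mul_smul, ← mul_smul, hν]; congr 1; group
    have h1 := hM _ (mem_doubleDiff hwW hαW hα₀W hw₀W) (ν • m) hw₀M (by rwa [hratio])
    rw [h1, one_smul] at hratio
    -- Equality of points is upgraded to equality of group elements by freeness, so that the label
    -- `w` is the position of the partner as seen from `ν • m`.
    have h2 : (w⁻¹ * α * δ * ν⁻¹) • ν • m = ν • m := by
      rw [hνx, mul_assoc, mul_smul, ← hratio]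
    have h3 := hfreeF _ (hF ▸ diff_mul_mem_windowSet hμK hwW hαW) _ h2
    have hwα : w = α * δ * ν⁻¹ := by
      rw [mul_assoc, mul_assoc, inv_mul_eq_one] at h3
      exact h3.trans (mul_assoc _ _ _).symm
    have hqF : α * δ * ν⁻¹ ∈ F := hF ▸ mul_snd_mul_fst_mem_windowSet hμK hαW
    have hpF : α * ν⁻¹ ∈ F := hF ▸ mul_fst_mem_windowSet hμK hαW
    have hqZ : α * δ * ν⁻¹ ∈ ownedPositions W (window F lab (ν • m)) := by
      rw [mem_ownedPositions hqF, hνx, hw, ← hwα]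
      exact ⟨hwW, rfl⟩
    refine mem_coloredPairs.2 ⟨hαW, Or.inr hqZ, Or.inr ?_, Or.inl hqZ⟩
    have hμF : ν⁻¹ ∈ F := hF ▸ fst_mem_windowSet hμK
    have hcμ : c (ν⁻¹ • ν • m) < c (ν • m) := by rwa [← hmx]
    simp only [visibleColor, window, if_pos hpF, hνx, hlabC α hαI, inv_mul_cancel_left, history,
      if_pos (And.intro hμF hcμ), Option.map_some, Option.isSome_some]
  · refine ⟨m, 1, h1K, by simp, hge.trans (Finset.card_le_card fun α hα => ?_)⟩
    obtain ⟨hαI', hnl⟩ := Finset.mem_filter.1 hα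
    have hαI := hI'I _ hαI'
    have hαW := hIW hαI
    have hpF : α * 1 ∈ F := hF ▸ mul_fst_mem_windowSet h1K hαW
    have hqF : α * δ * 1 ∈ F := hF ▸ mul_snd_mul_fst_mem_windowSet h1K hαW
    rw [mul_one] at hpF hqF
    have hpZ : α ∈ ownedPositions W (window F lab m) :=
      (mem_ownedPositions hpF).2 ⟨hαW, hlabC α hαI⟩
    refine mem_coloredPairs.2 ⟨hαW, ?_⟩
    rw [mul_one, mul_one]
    refine ⟨Or.inl hpZ, Or.inl hpZ, ?_⟩
    rcases hl : lab ((α * δ) • m) with _ | (a | w)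
    · exact absurd hl (hlabδ α hαI')
    · right
      simp [visibleColor, window, hqF, hl]
    · obtain ⟨hwW, hwM⟩ := pointLabel_eq_inr hl
      have hσ : w⁻¹ * (α * δ) ∈ F := by
        have := diff_mul_mem_windowSet (T := doubleDiff W) h1K hwW hαW
        rw [← hF, mul_one, mul_assoc] at this
        exact this
      have hle : c ((w⁻¹ * (α * δ)) • m) ≤ c m := by
        rw [mul_smul]
        exact not_lt.1 fun h => hnl ⟨w, hl, h⟩
      -- An owner of smaller rank has already been coloured; one of equal rank is `m` itself,
      -- because the ranking is proper on `F`.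
      rcases hle.lt_or_eq with hlt | heq
      · right
        simp [visibleColor, window, hqF, hl, history, hσ, hlt]
      · left
        have h1 := hc _ hσ m heq
        rw [inv_mul_eq_one] at h1
        rw [mem_ownedPositions hqF, hl, ← h1]
        exact ⟨hwW, rfl⟩

theorem exists_coloring {Γ : Type*} [Group Γ] [Countable Γ] [Infinite Γ]
    (k : ℕ) (hk : 2 ≤ k) [NeZero k] (R : Finset Γ) (hR : R.Nonempty) (γ : Γ) (hγ : γ ≠ 1) :
    ∃ S : Finset Γ,
      ∀ (X : Type*) [TopologicalSpace X] [T2Space X] [SecondCountableTopology X] [MulAction Γ X]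
        [ContinuousConstSMul Γ X],
        IsZeroDimensional X → IsFreeOn (S : Set Γ) X →
        ∀ C₀ C U : Set X, IsClopen C₀ → IsClopen C → Disjoint C₀ C → C₀ ∪ C ∪ U = Set.univ →
          IsSyndetic (R : Set Γ) C → IsSeparated (S : Set Γ) U →
          ∀ f₀ : X → Fin k, IsLocallyConstant f₀ →
            ∃ f : X → Fin k, IsLocallyConstant f ∧ (∀ x ∈ C₀, f x = f₀ x) ∧
              ∀ x : X, ∃ σ ∈ S, σ • x ∈ C₀ ∪ C ∧ (σ * γ) • x ∈ C₀ ∪ C ∧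
                f (σ • x) ≠ f ((σ * γ) • x) := by
  classical
  obtain ⟨t, ht1, ht⟩ := exists_poly_lt_two_pow R.card
  obtain ⟨W, hWc, hW⟩ := exists_finset_meeting_syndetic R (4 * t)
  have hWne : W.Nonempty := by
    obtain ⟨I, hIW, hI, -⟩ := hW Set.univ fun β => ⟨_, hR.choose_spec, trivial⟩
    exact (Finset.card_pos.1 (by omega)).mono hIW
  obtain ⟨w₁, hw₁⟩ := hWne
  set T := doubleDiff W with hT
  set K := constraintSet γ W T with hK
  have hKc : K.card < 2 ^ t := by
    refine ((card_constraintSet_le γ W).trans ?_).trans_lt ht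
    gcongr
  have hK1 : ∀ κ ∈ K, κ.2 ≠ 1 := fun κ hκ => ne_one_of_mem_constraintSet hγ hκ
  set F := windowSet W T K with hF
  -- `F` serves freeness and the ranking, `W * T` contains the final witness `α * σ`, and `W * W⁻¹`
  -- lets separation of `U` act inside a translate of `W`.
  refine ⟨F ∪ W * T ∪ W * W⁻¹, ?_⟩
  intro X _ _ _ _ _ hX hfree C₀ C U hC₀ hC hdisj hcover hsynd hU f₀ hf₀
  set S := F ∪ W * T ∪ W * W⁻¹ with hS
  have hFS : (F : Set Γ) ⊆ (S : Set Γ) := fun σ hσ =>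
    Finset.mem_union_left _ (Finset.mem_union_left _ hσ)
  have hWS : ∀ α ∈ W, ∀ β ∈ W, α * β⁻¹ ∈ (S : Set Γ) := fun α hα β hβ =>
    Finset.mem_union_right _ (Finset.mul_mem_mul hα (Finset.inv_mem_inv hβ))
  have hfreeF : IsFreeOn (F : Set Γ) X := fun x σ hσ => hfree x ⟨hFS hσ.1, hσ.2⟩
  obtain ⟨c, hc, hcF⟩ := exists_proper_ranking hX F hfreeF
  obtain ⟨M, hM, hMsep, hMmax⟩ := exists_maximal_separated T
    (by simpa using diff_mem_doubleDiff hw₁ hw₁) (fun σ hσ => inv_mem_doubleDiff hσ) hc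
    fun σ hσ => hcF σ (subset_windowSet hσ)
  set lab := pointLabel W M C₀ C f₀ with hlab
  have hlabc : IsLocallyConstant lab := isLocallyConstant_pointLabel hM hC₀ hC hf₀
  choose Ψ hΨ using fun (L : Γ → Option (Option (Fin k ⊕ Γ))) (h : Γ → Option (Γ → Fin k)) =>
    exists_overlay_ne hk t W (ownedPositions W L) (visibleColor L h) K hK1 hKc
  obtain ⟨g, hg, hgx⟩ := exists_greedy F hlabc hc Ψ
  refine ⟨blockColoring lab g, isLocallyConstant_blockColoring hlabc hg, fun x hx => ?_,
    fun y => ?_⟩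
  · simp [blockColoring, hlab, pointLabel_of_mem hx]
  obtain ⟨σ, hσT, hσM⟩ := hMmax y
  -- Taking `τ = σ⁻¹` gives `δ = σ * γ * σ⁻¹`, so `α * δ` moves the marker `σ • y` to `(α * σ * γ) •
  -- y`.
  have hτ : σ⁻¹ ∈ T := inv_mem_doubleDiff hσT
  have hP : ∀ β, ∃ ρ ∈ R, ρ * β ∈ {α : Γ | α • σ • y ∈ C} := by
    intro β
    have : β • σ • y ∈ (R : Set Γ)⁻¹ • C := by
      rw [show (R : Set Γ)⁻¹ • C = Set.univ from hsynd]; trivial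
    obtain ⟨ρ, hρ, z, hz, hρz⟩ := Set.mem_smul.1 this
    refine ⟨ρ⁻¹, hρ, ?_⟩
    rw [Set.mem_ofPred_eq, mul_smul, ← hρz, inv_smul_smul]
    exact hz
  obtain ⟨I, hIW, hIc, hIC⟩ := hW _ hP
  obtain ⟨x, μ, hμK, hmx, hcol⟩ := exists_base_with_coloredPairs (n := 2 * t) (f₀ := f₀)
    (by omega) hF hFS hWS hfree hcF hMsep hdisj hcover hU (σ • y) hσM hτ I hIW (by omega) hIC g
  obtain ⟨α, hαW, a, b, ha, hb, hab⟩ := hΨ _ (history F c g x) _ _ hμK hcol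
  rw [← hgx] at ha hb
  obtain ⟨ha1, ha2⟩ := blockColoring_of_overlay (mul_fst_mem_windowSet hμK hαW) ha
  obtain ⟨hb1, hb2⟩ := blockColoring_of_overlay (mul_snd_mul_fst_mem_windowSet hμK hαW) hb
  have e1 : (α * μ) • x = (α * σ) • y := by rw [mul_smul, ← hmx, mul_smul]
  have e2 : (α * (σ⁻¹⁻¹ * γ * σ⁻¹) * μ) • x = (α * σ * γ) • y := by
    rw [mul_smul, ← hmx, ← mul_smul]; congr 1; group
  rw [e1] at ha1 ha2
  rw [e2] at hb1 hb2
  refine ⟨α * σ, Finset.mem_union_left _ (Finset.mem_union_right _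
    (Finset.mul_mem_mul hαW hσT)), ?_, ?_, ?_⟩
  · exact not_not.1 fun h => ha1 (pointLabel_eq_none_iff.2 h)
  · exact not_not.1 fun h => hb1 (pointLabel_eq_none_iff.2 h)
  · rw [ha2, hb2]
    exact hab

theorem exists_isLocallyConstant_extension {X Y : Type*} [TopologicalSpace X]
    [TopologicalSpace Y] [DiscreteTopology Y] [Nonempty Y] {V : Set X} (hV : IsClopen V)
    {f : V → Y} (hf : Continuous f) :
    ∃ F : X → Y, IsLocallyConstant F ∧ ∀ (x : X) (hx : x ∈ V), F x = f ⟨x, hx⟩ := by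
  classical
  obtain ⟨y₀⟩ := ‹Nonempty Y›
  let F : X → Y := fun x => if h : x ∈ V then f ⟨x, h⟩ else y₀
  have hFV : ∀ (x : X) (hx : x ∈ V), F x = f ⟨x, hx⟩ := fun x hx => dif_pos hx
  refine ⟨F, isLocallyConstant_iff.2 fun x => ?_, hFV⟩
  by_cases hx : x ∈ V
  · have h1 : ∀ᶠ y : V in nhds ⟨x, hx⟩, F y = F x := by
      filter_upwards [isLocallyConstant_iff.1 ((IsLocallyConstant.iff_continuous f).2 hf)
        ⟨x, hx⟩] with y hy
      rw [hFV _ y.2, hFV _ hx]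
      exact hy
    rw [← map_nhds_subtype_coe_eq_nhds hx (hV.isOpen.mem_nhds hx)]
    exact h1
  · filter_upwards [hV.compl.isOpen.mem_nhds hx] with y hy
    have hy : y ∉ V := hy
    simp [F, hx, hy]

end ContinuousCombinatorics

theorem mainTheorem7 {Γ : Type*} [Group Γ] [Countable Γ] [Infinite Γ]
    (k : ℕ) (hk : 2 ≤ k) (R : Finset Γ) (γ : Γ) (hγ : γ ≠ 1) :
    ∃ S : Finset Γ,
      ∀ (X : Type*) [TopologicalSpace X] [PolishSpace X] [MulAction Γ X]
        [ContinuousConstSMul Γ X],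
        ContinuousCombinatorics.IsZeroDimensional X →
        ContinuousCombinatorics.IsFreeOn (S : Set Γ) X →
        ∀ C₀ C U : Set X,
          IsClopen C₀ → IsClopen C → IsClopen U →
          Disjoint C₀ C → Disjoint C₀ U → Disjoint C U →
          C₀ ∪ C ∪ U = Set.univ →
          ContinuousCombinatorics.IsSyndetic (R : Set Γ) C →
          ContinuousCombinatorics.IsSeparated (S : Set Γ) U →
          ∀ f₀ : C₀ → Fin k, Continuous f₀ →
            ∃ f : (C₀ ∪ C : Set X) → Fin k,
              Continuous f ∧
              (∀ (x : X) (hx : x ∈ C₀), f ⟨x, Or.inl hx⟩ = f₀ ⟨x, hx⟩) ∧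
              ∀ x : X, ∃ σ ∈ S,
                ∃ (h₁ : σ • x ∈ C₀ ∪ C) (h₂ : (σ * γ) • x ∈ C₀ ∪ C),
                  f ⟨σ • x, h₁⟩ ≠ f ⟨(σ * γ) • x, h₂⟩ := by
  classical
  have : NeZero k := ⟨by omega⟩
  -- Adding `1` makes `R` nonempty, which forces `W` to be nonempty and hence `1 ∈ T`; enlarging `R`
  -- preserves syndeticity.
  obtain ⟨S, hS⟩ := ContinuousCombinatorics.exists_coloring k hk (insert 1 R)
    (Finset.insert_nonempty _ _) γ hγ
  refine ⟨S, ?_⟩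
  intro X _ _ _ _ hX hfree C₀ C U hC₀ hC _ hdisj _ _ hcover hsynd hU f₀ hf₀
  obtain ⟨f₀', hf₀', hext⟩ :=
    ContinuousCombinatorics.exists_isLocallyConstant_extension hC₀ hf₀
  have hsynd' : ContinuousCombinatorics.IsSyndetic ((insert 1 R : Finset Γ) : Set Γ) C := by
    have h1 : (R : Set Γ)⁻¹ • C = Set.univ := hsynd
    refine Set.eq_univ_of_univ_subset (h1 ▸ Set.smul_subset_smul_right ?_)
    exact Set.inv_subset_inv.2 (Finset.coe_subset.2 (Finset.subset_insert _ _))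
  obtain ⟨f, hf, hf0, hfx⟩ := hS X hX hfree C₀ C U hC₀ hC hdisj hcover hsynd' hU f₀' hf₀'
  refine ⟨fun x => f x, hf.continuous.comp continuous_subtype_val,
    fun x hx => (hf0 x hx).trans (hext x hx), fun x => ?_⟩
  obtain ⟨σ, hσ, h1, h2, h3⟩ := hfx x
  exact ⟨σ, hσ, h1, h2, h3⟩
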